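/- Draw Young diagrams in the French convention (left-justified rows of weakly decreasing length, the longest row southernmost), and let a standard Young tableau $T$ with $n$ cells have entries $1,\dots,n$, each once, increasing eastward along rows and northward up columns. For $1\le i<m\le n$ say, recursively, that $i$ *attacks* $m$ in $T$ if $i$ lies strictly south and weakly east of $m$, or if $i$ lies strictly south and strictly west of $m$ and $i+1$ attacks $m$. For $1\le k\le 3$ put $$\mathrm{Des}_k(T)=\{(i,i+k)\;:\;1\le i,\ i+k\le n,\ i\text{ attacks }i+k\},\qquad \mathrm{Inv}_k(T)=\bigcup_{1\le j<k}\mathrm{Des}_j(T),$$ $$\mathrm{maj}_k(T)=|\mathrm{Inv}_k(T)|+\sum_{(i,i+k)\in \mathrm{Des}_k(T)} i .$$ Say that $m$ *splits* the pair $a,b$ (where $a,b<m$) if exactly one of $a,b$ attacks $m$. For $k\in\{2,3\}$ and $1\le j\le n$, let $\Gamma^{(k)}_j(T)$ be the smallest set of positive integers such that: $j-k\in\Gamma^{(k)}_j(T)$ if $j-k\ge 1$ and $j$ splits $j-k,\,j-k+1$; and, whenever $i\in\Gamma^{(k)}_j(T)$ and $i-k\ge1$, $i-k\in\Gamma^{(k)}_j(T)$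 if exactly one of $i,\,i+1$ splits $i-k,\,i-k+1$. Let $\gamma^{(k)}_j(T)$ be obtained from $T$ by interchanging the entries $i$ and $i+1$ for every $i\in\Gamma^{(k)}_j(T)$, and let $$\Phi^{(k)}=\gamma^{(k)}_n\circ\gamma^{(k)}_{n-1}\circ\cdots\circ\gamma^{(k)}_1 .$$ **Proposition.** Let $k\in\{2,3\}$ and let $\lambda$ be a partition. Then $\Phi^{(k)}$ is a bijection from the set of standard Young tableaux of shape $\lambda$ to itself, and for every standard Young tableau $T$ of shape $\lambda$, $$\mathrm{maj}_{k-1}(T)=\mathrm{maj}_k\bigl(\Phi^{(k)}(T)\bigr).$$ -/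

import Mathlib

/-- The standard Young tableaux of shape `μ`, as functions `T` on the lattice quadrant: the cells of
`μ` are labelled bijectively by `1, …, μ.card`, all other lattice points carry the label `0`, and
the labels increase strictly along rows and columns. A lattice point is `(row, column)`; row `0` is
the southernmost (longest) row, so "north" means larger row index and "east" larger column index. -/
def SYT (μ : YoungDiagram) : Set (ℕ × ℕ → ℕ) :=
  {T | Set.BijOn T (μ.cells : Set (ℕ × ℕ)) (Set.Icc 1 μ.card) ∧
    (∀ c, c ∉ μ → T c = 0) ∧
    (∀ r c₁ c₂, c₁ < c₂ → (r, c₂) ∈ μ → T (r, c₁) < T (r, c₂)) ∧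
    (∀ r₁ r₂ c, r₁ < r₂ → (r₂, c) ∈ μ → T (r₁, c) < T (r₂, c))}

namespace SYT

/-- The cell `(row, column)` that carries the label `a` (only used for labels that occur
exactly once). -/
noncomputable def cell (T : ℕ × ℕ → ℕ) (a : ℕ) : ℕ × ℕ := Function.invFun T a

/-- `Attacks T i m`: `i` attacks `m` in `T`. For `i < m` this holds if `i` lies strictly south and
weakly east of `m`, or if `i` lies strictly southwest of `m` and `i + 1` attacks `m`. -/
inductive Attacks (T : ℕ × ℕ → ℕ) : ℕ → ℕ → Prop
  | southeast {i m : ℕ} (lt : i < m) (south : (cell T i).1 < (cell T m).1)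
      (east : (cell T m).2 ≤ (cell T i).2) : Attacks T i m
  | southwest {i m : ℕ} (lt : i < m) (south : (cell T i).1 < (cell T m).1)
      (west : (cell T i).2 < (cell T m).2) (next : Attacks T (i + 1) m) : Attacks T i m

open Classical in
/-- The `k`-descent set of a tableau with `n` cells: pairs `(i, i + k)` of labels such that `i`
attacks `i + k`. -/
noncomputable def Des (n k : ℕ) (T : ℕ × ℕ → ℕ) : Finset (ℕ × ℕ) :=
  (Finset.Icc 1 n ×ˢ Finset.Icc 1 n).filter fun p => p.2 = p.1 + k ∧ Attacks T p.1 p.2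

/-- The `k`-inversion set: the union of the `j`-descent sets for `1 ≤ j < k`. -/
noncomputable def Inv (n k : ℕ) (T : ℕ × ℕ → ℕ) : Finset (ℕ × ℕ) :=
  (Finset.Ico 1 k).biUnion fun j => Des n j T

/-- The `k`-major index. -/
noncomputable def maj (n k : ℕ) (T : ℕ × ℕ → ℕ) : ℕ :=
  (Inv n k T).card + ∑ p ∈ Des n k T, p.1

/-- `m` splits the pair `a, b` if exactly one of `a`, `b` attacks `m`. -/
def Splits (T : ℕ × ℕ → ℕ) (m a b : ℕ) : Prop := Xor (Attacks T a m) (Attacks T b m)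

/-- Membership in the set `Γ_j^{(k)}(T)` of labels: the label `i = j - k ≥ 1` belongs to it if `j`
splits `i, i + 1`; and if `i + k` belongs to it, then so does `i ≥ 1` if exactly one of
`i + k`, `i + k + 1` splits `i, i + 1`. -/
inductive MemΓ (k j : ℕ) (T : ℕ × ℕ → ℕ) : ℕ → Prop
  | base {i : ℕ} (pos : 1 ≤ i) (eq : i + k = j) (split : Splits T j i (i + 1)) : MemΓ k j T i
  | step {i : ℕ} (pos : 1 ≤ i) (mem : MemΓ k j T (i + k))
      (split : Xor (Splits T (i + k) i (i + 1)) (Splits T (i + k + 1) i (i + 1))) : MemΓ k j T i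

open Classical in
/-- The product of the transpositions `(i, i + 1)` for `i ∈ S`, where `S` has no two consecutive
elements: it interchanges `i` and `i + 1` for every `i ∈ S` and fixes everything else. -/
noncomputable def interchange (S : Set ℕ) (a : ℕ) : ℕ :=
  if a ∈ S then a + 1 else if 1 ≤ a ∧ a - 1 ∈ S then a - 1 else a

/-- `γ_j^{(k)}` interchanges the labels `i` and `i + 1` for all `i ∈ Γ_j^{(k)}(T)`. For `k ≥ 2` no
two elements of `Γ_j^{(k)}(T)` are consecutive, as they are all congruent to `j` modulo `k`. -/
noncomputable def γ (k j : ℕ) (T : ℕ × ℕ → ℕ) : ℕ × ℕ → ℕ :=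
  fun c => interchange {i | MemΓ k j T i} (T c)

/-- `Φ k n = γ_n^{(k)} ∘ ⋯ ∘ γ_1^{(k)}`, for tableaux with `n` cells. -/
noncomputable def Φ (k : ℕ) : ℕ → (ℕ × ℕ → ℕ) → (ℕ × ℕ → ℕ)
  | 0, T => T
  | m + 1, T => γ k (m + 1) (Φ k m T)

end SYT

/-!
Everything is read off from the *content word* of `T`, whose `i`-th letter is the content (column
minus row) of the cell with label `i`. Between two equal letters `c` of a content word both `c + 1`
and `c - 1` occur (`isContentWord`), so equal letters are at least three positions apart, and those
at distance three or four are tightly constrained. For labels at distance at most four, `i` attacks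
`m` if and only if the letter at `i` is larger than the one at `m`, a tie being decided by the
letter at `i + 1` (`attacks_iff_beats`). Hence attacking is essentially the inversion relation of a
word, and the maps `γ` are those of Kadell's bijections for words.

The set `S` of labels that `γ k j` moves is a chain in a residue class modulo `k`. If `i ∈ S`, the
letters at `i` and `i + 1` differ by at least two (`IsChain.apart_two`, `IsChain.apart_three`), so
the two cells are not adjacent and `γ k j T` is again a standard tableau. Exchanging the letters
does not change which pairs split which, so the exchanged word has the same chain
(`IsChain.comp_interchange`). Hence `γ k j` is an involution, and `Φ` is bijective.

For the statistic, consider how the exchange alters the `k`-major index of a prefix that ends just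
before position `i + k`, where `i ≡ j` modulo `k`. Going up from one such prefix to the next, the
splitting condition makes the altered pairs between two blocks cancel (`IsChain.ind_cross`), and
what remains is the change of the single pair `(i, i + 1)` (`IsChain.wordMaj_two`,
`IsChain.wordMaj_three`). At the top of the chain this remainder turns the contribution of `j` to
the `k`-major index into its contribution to the `(k - 1)`-major index (`IsChain.wordMaj_comp`). As
the earlier maps `γ k 1, …, γ k (j - 1)` do not move the labels that the latter depends on,
induction on `j` gives the theorem (`wordMaj_Φ`).
-/

namespace SYT

/-! ### Content words and chains -/

/-- `Beats w i m` says that the `i`-th letter of `w` exceeds the `m`-th one, a tie being decided by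
the letter that follows position `i`. For the content word of a standard tableau and
`i < m ≤ i + 4`, this is the relation `Attacks`. -/
def Beats (w : ℕ → ℤ) (i m : ℕ) : Prop := w m < w i ∨ (w i = w m ∧ w m < w (i + 1))

/-- The word-level form of `Splits`: exactly one of the positions `a`, `b` beats `m`. -/
def Cuts (w : ℕ → ℤ) (m a b : ℕ) : Prop := ¬(Beats w a m ↔ Beats w b m)

/-- The property of content words of standard tableaux that the argument uses: between two equal
letters `c` among the first `n` ones, both `c + 1` and `c - 1` occur. -/
def IsContentWord (n : ℕ) (w : ℕ → ℤ) : Prop :=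
  ∀ i m, 1 ≤ i → i < m → m ≤ n → w i = w m →
    (∃ a, i < a ∧ a < m ∧ w a = w i + 1) ∧ (∃ b, i < b ∧ b < m ∧ w b = w i - 1)

/-- A characterization of the set `{i | MemΓ k j T i}` in terms of the content word `w` of `T`. It
determines `S`, see `IsChain.unique`. -/
structure IsChain (k j : ℕ) (w : ℕ → ℤ) (S : Set ℕ) : Prop where
  pos_step : 1 ≤ k
  pos : ∀ {i}, i ∈ S → 1 ≤ i
  le : ∀ {i}, i ∈ S → i + k ≤ j
  top : ∀ {i}, 1 ≤ i → i + k = j → (i ∈ S ↔ Cuts w j i (i + 1))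
  next : ∀ {i}, 1 ≤ i → i + k ∈ S →
    (i ∈ S ↔ ¬(Cuts w (i + k) i (i + 1) ↔ Cuts w (i + k + 1) i (i + 1)))
  up : ∀ {i}, i ∈ S → i + k = j ∨ i + k ∈ S

namespace IsContentWord

variable {n : ℕ} {w : ℕ → ℤ}

theorem ne_one (h : IsContentWord n w) {i : ℕ} (hi : 1 ≤ i) (hn : i + 1 ≤ n) :
    w i ≠ w (i + 1) := by
  intro e
  obtain ⟨⟨a, h1, h2, -⟩, -⟩ := h i (i + 1) hi (by omega) hn e
  omega

theorem ne_two (h : IsContentWord n w) {i : ℕ} (hi : 1 ≤ i) (hn : i + 2 ≤ n) :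
    w i ≠ w (i + 2) := by
  intro e
  obtain ⟨⟨a, h1, h2, h3⟩, ⟨b, h4, h5, h6⟩⟩ := h i (i + 2) hi (by omega) hn e
  obtain rfl : a = b := by omega
  omega

theorem eq_three (h : IsContentWord n w) {i : ℕ} (hi : 1 ≤ i) (hn : i + 3 ≤ n)
    (e : w i = w (i + 3)) : (w (i + 1) = w i + 1 ∧ w (i + 2) = w i - 1) ∨
      (w (i + 1) = w i - 1 ∧ w (i + 2) = w i + 1) := by
  obtain ⟨⟨a, h1, h2, h3⟩, ⟨b, h4, h5, h6⟩⟩ := h i (i + 3) hi (by omega) hn e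
  obtain rfl | rfl : a = i + 1 ∨ a = i + 2 := by omega
  all_goals
    obtain rfl | rfl : b = i + 1 ∨ b = i + 2 := by omega
    all_goals omega

theorem eq_four (h : IsContentWord n w) {i : ℕ} (hi : 1 ≤ i) (hn : i + 4 ≤ n)
    (e : w i = w (i + 4)) :
    (w (i + 1) = w i + 1 ∨ w (i + 2) = w i + 1 ∨ w (i + 3) = w i + 1) ∧
      (w (i + 1) = w i - 1 ∨ w (i + 2) = w i - 1 ∨ w (i + 3) = w i - 1) := by
  obtain ⟨⟨a, h1, h2, h3⟩, ⟨b, h4, h5, h6⟩⟩ := h i (i + 4) hi (by omega) hn e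
  constructor
  · obtain rfl | rfl | rfl : a = i + 1 ∨ a = i + 2 ∨ a = i + 3 := by omega
    all_goals simp [h3]
  · obtain rfl | rfl | rfl : b = i + 1 ∨ b = i + 2 ∨ b = i + 3 := by omega
    all_goals simp [h6]

end IsContentWord

namespace IsChain

variable {n k j : ℕ} {w : ℕ → ℤ} {S : Set ℕ}

/-- Downward induction along a chain, from its top element `j - k`. -/
theorem rec_down (h : IsChain k j w S) {P : ℕ → Prop}
    (top : ∀ i, 1 ≤ i → i + k = j → Cuts w j i (i + 1) → P i)
    (next : ∀ i, 1 ≤ i → i + k ∈ S → P (i + k) →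
      ¬(Cuts w (i + k) i (i + 1) ↔ Cuts w (i + k + 1) i (i + 1)) → P i)
    {i : ℕ} (hi : i ∈ S) : P i := by
  induction hd : j - i using Nat.strong_induction_on generalizing i with
  | _ d ih =>
    have h1 := h.pos hi
    have hk := h.pos_step
    rcases h.up hi with e | e
    · exact top i h1 e ((h.top h1 e).1 hi)
    · have := h.le e
      exact next i h1 e (ih _ (by omega) e rfl) ((h.next h1 e).1 hi)

theorem mod_eq (h : IsChain k j w S) {i : ℕ} (hi : i ∈ S) : i % k = j % k :=
  h.rec_down (P := fun i => i % k = j % k) (fun i _ e _ => by rw [← e, Nat.add_mod_right])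
    (fun i _ _ e _ => by rw [← e, Nat.add_mod_right]) hi

/-- A chain is determined by the relations `Cuts`, tested along the chain only. -/
theorem unique {w' : ℕ → ℤ} {S' : Set ℕ} (h : IsChain k j w S) (h' : IsChain k j w' S') :
    (∀ i, 1 ≤ i → i + k = j → (Cuts w j i (i + 1) ↔ Cuts w' j i (i + 1))) →
    (∀ i, 1 ≤ i → i + k ∈ S →
      ((Cuts w (i + k) i (i + 1) ↔ Cuts w (i + k + 1) i (i + 1)) ↔
        (Cuts w' (i + k) i (i + 1) ↔ Cuts w' (i + k + 1) i (i + 1)))) → S = S' := by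
  intro ht hn
  have hsub : ∀ {i}, i ∈ S → i ∈ S' :=
    h.rec_down (fun i h1 e c => (h'.top h1 e).2 ((ht i h1 e).1 c))
      (fun i h1 e e' c => (h'.next h1 e').2 ((not_congr (hn i h1 e)).1 c))
  refine Set.Subset.antisymm (fun i => hsub) fun i => ?_
  exact h'.rec_down (P := (· ∈ S)) (fun i h1 e c => (h.top h1 e).2 ((ht i h1 e).2 c))
      (fun i h1 e e' c => (h.next h1 e').2 ((not_congr (hn i h1 e')).2 c))

/-- Letters exchanged along a chain are not neighbours in the ordering of `ℤ`, so the corresponding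
cells of a tableau are not adjacent. -/
theorem apart_two (hw : IsContentWord n w) (h : IsChain 2 j w S) (hj : j ≤ n) {i : ℕ}
    (hi : i ∈ S) : w i + 2 ≤ w (i + 1) ∨ w (i + 1) + 2 ≤ w i := by
  refine h.rec_down (P := fun i => w i + 2 ≤ w (i + 1) ∨ w (i + 1) + 2 ≤ w i) ?_ ?_ hi
  · rintro i h1 rfl c
    have a1 := hw.ne_one h1 (by omega)
    have a2 := hw.ne_two h1 (by omega)
    have a3 := hw.ne_one (i := i + 1) (by omega) (by omega)
    simp only [Cuts, Beats, add_assoc, Nat.reduceAdd] at *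
    omega
  · intro i h1 hS ih c
    have := h.le hS
    have a1 := hw.ne_one h1 (by omega)
    have a2 := hw.ne_two h1 (by omega)
    have a3 := hw.ne_one (i := i + 1) (by omega) (by omega)
    have a4 := hw.ne_two (i := i + 1) (by omega) (by omega)
    have a5 := hw.eq_three h1 (by omega)
    simp only [Cuts, Beats, add_assoc, Nat.reduceAdd] at *
    omega

theorem apart_three (hw : IsContentWord n w) (h : IsChain 3 j w S) (hj : j ≤ n) {i : ℕ}
    (hi : i ∈ S) : w i + 2 ≤ w (i + 1) ∨ w (i + 1) + 2 ≤ w i := by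
  refine h.rec_down (P := fun i => w i + 2 ≤ w (i + 1) ∨ w (i + 1) + 2 ≤ w i) ?_ ?_ hi
  · rintro i h1 rfl c
    have a1 := hw.ne_one h1 (by omega)
    have a2 := hw.ne_two (i := i + 1) (by omega) (by omega)
    have a5 := hw.eq_three h1 (by omega)
    simp only [Cuts, Beats, add_assoc, Nat.reduceAdd] at *
    omega
  · intro i h1 hS ih c
    have := h.le hS
    have a1 := hw.ne_one h1 (by omega)
    have a2 := hw.ne_two (i := i + 1) (by omega) (by omega)
    have a3 := hw.eq_three h1 (by omega)
    have a4 := hw.eq_three (i := i + 1) (by omega) (by omega)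
    have a5 := hw.eq_four h1 (by omega)
    simp only [Cuts, Beats, add_assoc, Nat.reduceAdd] at *
    omega

/-- For `k = 3`, the letter after an exchanged pair `c + 1, c - 1` is never `c`. Exchanging such a
pair would reverse how a tie between two letters `c` is decided. -/
theorem not_straddle (hw : IsContentWord n w) (h : IsChain 3 j w S) (hj : j ≤ n) {i : ℕ}
    (hi : i ∈ S) : ¬(w i = w (i + 2) + 1 ∧ w (i + 1) = w (i + 2) - 1) ∧
      ¬(w i = w (i + 2) - 1 ∧ w (i + 1) = w (i + 2) + 1) := by
  have h1 := h.pos hi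
  rcases h.up hi with e | e
  · have c := (h.top h1 e).1 hi
    subst e
    have a2 := hw.ne_two (i := i + 1) (by omega) (by omega)
    have a3 := hw.ne_one (i := i + 2) (by omega) (by omega)
    have a5 := hw.eq_three h1 (by omega)
    simp only [Cuts, Beats, add_assoc, Nat.reduceAdd] at *
    omega
  · have c := (h.next h1 e).1 hi
    have := h.le e
    have ap := h.apart_three hw hj e
    have a1 := hw.ne_two (i := i + 1) (by omega) (by omega)
    have a2 := hw.ne_two (i := i + 2) (by omega) (by omega)
    have a6 := hw.ne_one (i := i + 2) (by omega) (by omega)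
    have a3 := hw.eq_three h1 (by omega)
    have a4 := hw.eq_three (i := i + 1) (by omega) (by omega)
    have a5 := hw.eq_four h1 (by omega)
    simp only [Cuts, Beats, add_assoc, Nat.reduceAdd] at *
    omega

end IsChain

/-! ### Exchanging letters along a chain -/

theorem interchange_of_notMem {S : Set ℕ} {a : ℕ} (h : a ∉ S) (h' : a - 1 ∉ S) :
    interchange S a = a := by
  simp [interchange, h, h']

namespace IsChain

variable {n k j : ℕ} {w : ℕ → ℤ} {S : Set ℕ}

theorem interchange_apply (h : IsChain k j w S) (hk : 2 ≤ k) {i : ℕ} (hi : i % k = j % k) :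
    (i ∈ S → interchange S i = i + 1) ∧ (i ∉ S → interchange S i = i) ∧
      (i ∈ S → interchange S (i + 1) = i) ∧ (i ∉ S → interchange S (i + 1) = i + 1) ∧
      (3 ≤ k → interchange S (i + 2) = i + 2) := by
  have key : ∀ a, (a + 1) % k = a % k → False := fun a e => by
    have h1 : a + 1 ≡ a + 0 [MOD k] := e
    have := Nat.ModEq.add_left_cancel' a h1
    rw [Nat.modEq_zero_iff_dvd, Nat.dvd_one] at this
    omega
  have key2 : ∀ a, 3 ≤ k → (a + 2) % k = a % k → False := fun a h3 e => by
    have h1 : a + 2 ≡ a + 0 [MOD k] := e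
    have := Nat.ModEq.add_left_cancel' a h1
    rw [Nat.modEq_zero_iff_dvd] at this
    have := Nat.le_of_dvd (by omega) this
    omega
  have p0 : 1 ≤ i → i - 1 ∉ S := fun h1 hS => key (i - 1) (by
    rw [h.mod_eq hS, Nat.sub_add_cancel h1, hi])
  have p1 : i + 1 ∉ S := fun hS => key i (by rw [h.mod_eq hS, hi])
  have p2 : 3 ≤ k → i + 2 ∉ S := fun h3 hS => key2 i h3 (by rw [h.mod_eq hS, hi])
  refine ⟨fun hS => ?_, fun hS => ?_, fun hS => ?_, fun hS => ?_, fun h3 => ?_⟩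
  · simp [interchange, hS]
  · simp only [interchange, hS, if_false]
    rw [if_neg (fun c => p0 c.1 c.2)]
  · simp [interchange, hS, p1]
  · simp [interchange, hS, p1]
  · simp [interchange, p1, p2 h3]

theorem comp_top (h : IsChain k j w S) (hk : 2 ≤ k) : (w ∘ interchange S) j = w j := by
  have : j ∉ S := fun hS => by have := h.le hS; omega
  simp [(h.interchange_apply hk rfl).2.1 this]

/-- How exchanging `i + k` and `i + k + 1`, and also `i` and `i + 1` if `i ∈ S`, permutes the
relation `Beats` between the two pairs of positions. -/
theorem beats_two (hw : IsContentWord n w) (h : IsChain 2 j w S) (hj : j ≤ n) {i : ℕ}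
    (h1 : 1 ≤ i) (hi : i + 2 ∈ S) :
    (i ∈ S → (Beats (w ∘ interchange S) i (i + 2) ↔ Beats w (i + 1) (i + 3)) ∧
      (Beats (w ∘ interchange S) i (i + 3) ↔ Beats w (i + 1) (i + 2)) ∧
      (Beats (w ∘ interchange S) (i + 1) (i + 2) ↔ Beats w i (i + 3)) ∧
      (Beats (w ∘ interchange S) (i + 1) (i + 3) ↔ Beats w i (i + 2))) ∧
    (i ∉ S → (Beats (w ∘ interchange S) i (i + 2) ↔ Beats w i (i + 3)) ∧
      (Beats (w ∘ interchange S) i (i + 3) ↔ Beats w i (i + 2)) ∧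
      (Beats (w ∘ interchange S) (i + 1) (i + 2) ↔ Beats w (i + 1) (i + 3)) ∧
      (Beats (w ∘ interchange S) (i + 1) (i + 3) ↔ Beats w (i + 1) (i + 2))) := by
  have hm := h.mod_eq hi
  have hle := h.le hi
  obtain ⟨s2, -, s3, -, -⟩ := h.interchange_apply le_rfl hm
  obtain ⟨s0, s0', s1, s1', -⟩ := h.interchange_apply (i := i) le_rfl (by omega)
  have ap := h.apart_two hw hj hi
  have ap' := fun hS : i ∈ S => h.apart_two hw hj hS
  have a1 := hw.ne_one h1 (by omega)
  have a2 := hw.ne_two h1 (by omega)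
  have a3 := hw.ne_one (i := i + 1) (by omega) (by omega)
  have a4 := hw.ne_two (i := i + 1) (by omega) (by omega)
  have a5 := hw.eq_three h1 (by omega)
  simp only [add_assoc, Nat.reduceAdd] at s2 s3 ap a3 a4
  refine ⟨fun hS => ?_, fun hS => ?_⟩
  · have e0 := s0 hS
    have e1 := s1 hS
    have e2 := s2 hi
    have e3 := s3 hi
    have ap' := ap' hS
    clear s0 s1 s0' s1' s2 s3
    simp only [Beats, Function.comp_apply, add_assoc, Nat.reduceAdd, e0, e1, e2, e3]
    refine ⟨?_, ?_, ?_, ?_⟩ <;> first | trivial | omega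
  · have e0 := s0' hS
    have e1 := s1' hS
    have e2 := s2 hi
    have e3 := s3 hi
    clear s0 s1 s0' s1' s2 s3 ap'
    simp only [Beats, Function.comp_apply, add_assoc, Nat.reduceAdd, e0, e1, e2, e3]
    refine ⟨?_, ?_, ?_, ?_⟩ <;> first | trivial | omega

/-- The analogue of `beats_two` for `k = 3`. Here ties at distances three and four do occur, and they
keep being decided in the same way. -/
theorem beats_three (hw : IsContentWord n w) (h : IsChain 3 j w S) (hj : j ≤ n) {i : ℕ}
    (h1 : 1 ≤ i) (hi : i + 3 ∈ S) :
    (i ∈ S → (Beats (w ∘ interchange S) i (i + 3) ↔ Beats w (i + 1) (i + 4)) ∧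
      (Beats (w ∘ interchange S) i (i + 4) ↔ Beats w (i + 1) (i + 3)) ∧
      (Beats (w ∘ interchange S) (i + 1) (i + 3) ↔ Beats w i (i + 4)) ∧
      (Beats (w ∘ interchange S) (i + 1) (i + 4) ↔ Beats w i (i + 3))) ∧
    (i ∉ S → (Beats (w ∘ interchange S) i (i + 3) ↔ Beats w i (i + 4)) ∧
      (Beats (w ∘ interchange S) i (i + 4) ↔ Beats w i (i + 3)) ∧
      (Beats (w ∘ interchange S) (i + 1) (i + 3) ↔ Beats w (i + 1) (i + 4)) ∧
      (Beats (w ∘ interchange S) (i + 1) (i + 4) ↔ Beats w (i + 1) (i + 3))) := by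
  have hm := h.mod_eq hi
  have hle := h.le hi
  obtain ⟨s3, -, s4, -, -⟩ := h.interchange_apply (by omega) hm
  obtain ⟨s0, s0', s1, s1', s2⟩ := h.interchange_apply (i := i) (by omega) (by omega)
  have ap := h.apart_three hw hj hi
  have ap' := fun hS : i ∈ S => h.apart_three hw hj hS
  have a1 := hw.ne_one h1 (by omega)
  have a3 := hw.ne_two (i := i + 1) (by omega) (by omega)
  have a4 := hw.eq_three (i := i + 1) (by omega) (by omega)
  have a5 := hw.eq_three h1 (by omega)
  have a6 := hw.eq_four h1 (by omega)
  simp only [add_assoc, Nat.reduceAdd] at s3 s4 ap a3 a4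
  have e4 := s2 le_rfl
  refine ⟨fun hS => ?_, fun hS => ?_⟩
  · have e0 := s0 hS
    have e1 := s1 hS
    have e2 := s3 hi
    have e3 := s4 hi
    have ap' := ap' hS
    clear s0 s1 s0' s1' s3 s4
    simp only [Beats, Function.comp_apply, add_assoc, Nat.reduceAdd, e0, e1, e2, e3]
    refine ⟨?_, ?_, ?_, ?_⟩ <;> first | trivial | omega
  · have e0 := s0' hS
    have e1 := s1' hS
    have e2 := s3 hi
    have e3 := s4 hi
    clear s0 s1 s0' s1' s3 s4 ap'
    simp only [Beats, Function.comp_apply, add_assoc, Nat.reduceAdd, e0, e1, e2, e3]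
    refine ⟨?_, ?_, ?_, ?_⟩ <;> first | trivial | omega

/-- The relation between the two positions around an exchanged pair is preserved: by `not_straddle`,
no tie between them is decided by that pair. -/
theorem beats_straddle (hw : IsContentWord n w) (h : IsChain 3 j w S) (hj : j ≤ n) {i : ℕ}
    (h1 : 1 ≤ i) (hi : i + 1 ∈ S) :
    Beats (w ∘ interchange S) i (i + 3) ↔ Beats w i (i + 3) := by
  have hm := h.mod_eq hi
  have hle := h.le hi
  obtain ⟨s1, -, s2, -, s3⟩ := h.interchange_apply (by omega) hm
  have s0 : interchange S i = i := by
    rcases Nat.lt_or_ge i 2 with h2 | h2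
    · obtain rfl : i = 1 := by omega
      have : 1 ∉ S := fun hS => by have := h.mod_eq hS; omega
      have h0 : 0 ∉ S := fun hS => by have := h.pos hS; omega
      simp [interchange, this, h0]
    · obtain ⟨p, rfl⟩ : ∃ p, i = p + 2 := ⟨i - 2, by omega⟩
      exact (h.interchange_apply (i := p) (by omega) (by omega)).2.2.2.2 le_rfl
  have ap := h.apart_three hw hj hi
  have st := h.not_straddle hw hj hi
  have a5 := hw.eq_three h1 (by omega)
  simp only [add_assoc, Nat.reduceAdd, le_refl, true_imp_iff, hi] at *
  simp only [Beats, Function.comp_apply, *]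
  omega

/-- Exchanging `i` and `i + 1` for the top element `i` of the chain exchanges their relations to
`j`. -/
theorem beats_top (hw : IsContentWord n w) (hk : k = 2 ∨ k = 3) (h : IsChain k j w S)
    (hj : j ≤ n) {i : ℕ} (e : i + k = j) (hS : i ∈ S) :
    (Beats (w ∘ interchange S) i j ↔ Beats w (i + 1) j) ∧
      (Beats (w ∘ interchange S) (i + 1) j ↔ Beats w i j) := by
  have h1 := h.pos hS
  have hm : i % k = j % k := h.mod_eq hS
  obtain ⟨s0, s0', s1, s1', s2⟩ := h.interchange_apply (by omega) hm
  have s3 := h.comp_top (by omega)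
  subst e
  simp only [Function.comp_apply] at s3
  have e0 := s0 hS
  have e1 := s1 hS
  rcases hk with rfl | rfl
  · have a1 := hw.ne_one (i := i + 1) (by omega) (by omega)
    have a2 := hw.ne_two h1 (by omega)
    simp only [Beats, Function.comp_apply, add_assoc, Nat.reduceAdd, e0, e1, s3] at *
    omega
  · have a2 := hw.ne_two (i := i + 1) (by omega) (by omega)
    have a3 := hw.eq_three h1 (by omega)
    have ap := h.apart_three hw hj hS
    simp only [Beats, Function.comp_apply, add_assoc, Nat.reduceAdd, e0, e1, s3,
      s2 le_rfl] at *
    omega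

/-- The exchanged word has the same chain. -/
theorem comp_interchange (hw : IsContentWord n w) (hk : k = 2 ∨ k = 3) (h : IsChain k j w S)
    (hj : j ≤ n) : IsChain k j (w ∘ interchange S) S := by
  refine ⟨h.pos_step, h.pos, h.le, ?_, ?_, h.up⟩
  · intro i h1 e
    rw [h.top h1 e]
    have hm : i % k = j % k := by rw [← e, Nat.add_mod_right]
    obtain ⟨s0, s0', s1, s1', s2⟩ := h.interchange_apply (by omega) hm
    have s3 := h.comp_top (by omega)
    by_cases hS : i ∈ S
    · obtain ⟨b1, b2⟩ := h.beats_top hw hk hj e hS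
      simp only [Cuts, b1, b2]
      exact not_congr iff_comm
    · subst e
      simp only [Function.comp_apply] at s3
      have e0 := s0' hS
      have e1 := s1' hS
      rcases hk with rfl | rfl
      · simp only [Cuts, Beats, Function.comp_apply, add_assoc, Nat.reduceAdd, e0, e1, s3]
      · simp only [Cuts, Beats, Function.comp_apply, add_assoc, Nat.reduceAdd, e0, e1, s3,
          s2 le_rfl]
  · intro i h1 hi
    rw [h.next h1 hi]
    rcases hk with rfl | rfl
    · obtain ⟨b, b'⟩ := h.beats_two hw hj h1 hi
      by_cases hS : i ∈ S
      · obtain ⟨b1, b2, b3, b4⟩ := b hS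
        simp only [Cuts, add_assoc, Nat.reduceAdd, b1, b2, b3, b4]
        grind
      · obtain ⟨b1, b2, b3, b4⟩ := b' hS
        simp only [Cuts, add_assoc, Nat.reduceAdd, b1, b2, b3, b4]
        grind
    · obtain ⟨b, b'⟩ := h.beats_three hw hj h1 hi
      by_cases hS : i ∈ S
      · obtain ⟨b1, b2, b3, b4⟩ := b hS
        simp only [Cuts, add_assoc, Nat.reduceAdd, b1, b2, b3, b4]
        grind
      · obtain ⟨b1, b2, b3, b4⟩ := b' hS
        simp only [Cuts, add_assoc, Nat.reduceAdd, b1, b2, b3, b4]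
        grind

end IsChain

/-! ### The major index of a word -/

open Classical in
/-- The indicator of the pair of positions `p`, `m` with `1 ≤ p` being counted by `Beats`. The
truncated position `p = m - k` is `0` if there is no position `k` steps before `m`. -/
noncomputable def ind (w : ℕ → ℤ) (p m : ℕ) : ℤ := if 1 ≤ p ∧ Beats w p m then 1 else 0

/-- The contribution of the pairs with larger element `m` to the `k`-major index. -/
noncomputable def majStep (k : ℕ) (w : ℕ → ℤ) (m : ℕ) : ℤ :=
  ∑ d ∈ Finset.Ico 1 k, ind w (m - d) m + ((m - k : ℕ) : ℤ) * ind w (m - k) m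

/-- The `k`-major index of the first `n` letters of `w`. -/
noncomputable def wordMaj (k n : ℕ) (w : ℕ → ℤ) : ℤ := ∑ m ∈ Finset.range n, majStep k w (m + 1)

theorem wordMaj_succ (k n : ℕ) (w : ℕ → ℤ) :
    wordMaj k (n + 1) w = wordMaj k n w + majStep k w (n + 1) := Finset.sum_range_succ _ _

theorem ind_zero (w : ℕ → ℤ) (m : ℕ) : ind w 0 m = 0 := by simp [ind]

open Classical in
theorem ind_congr {w w' : ℕ → ℤ} {p m q l : ℕ} (hp : 1 ≤ p) (hq : 1 ≤ q)
    (h : Beats w' p m ↔ Beats w q l) : ind w' p m = ind w q l := by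
  simp [ind, hp, hq, h]

theorem majStep_two (w : ℕ → ℤ) (m : ℕ) :
    majStep 2 w (m + 2) = ind w (m + 1) (m + 2) + m * ind w m (m + 2) := by
  simp [majStep]

theorem majStep_three (w : ℕ → ℤ) (m : ℕ) :
    majStep 3 w (m + 3) = ind w (m + 2) (m + 3) + ind w (m + 1) (m + 3) + m * ind w m (m + 3) := by
  simp [majStep, Finset.sum_Ico_succ_top]

theorem wordMaj_two_two (w : ℕ → ℤ) : wordMaj 2 2 w = ind w 1 2 := by
  simp [wordMaj, Finset.sum_range_succ, majStep, ind_zero]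

theorem wordMaj_two_three (w : ℕ → ℤ) : wordMaj 2 3 w = ind w 1 2 + (ind w 2 3 + ind w 1 3) := by
  simp [wordMaj, Finset.sum_range_succ, majStep, ind_zero]

theorem wordMaj_three_three (w : ℕ → ℤ) :
    wordMaj 3 3 w = ind w 1 2 + (ind w 2 3 + ind w 1 3) := by
  simp [wordMaj, Finset.sum_range_succ, majStep, ind_zero, Finset.sum_Ico_succ_top]

theorem wordMaj_three_four (w : ℕ → ℤ) :
    wordMaj 3 4 w = ind w 1 2 + (ind w 2 3 + ind w 1 3) +
      (ind w 3 4 + ind w 2 4 + ind w 1 4) := by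
  rw [wordMaj_succ, wordMaj_three_three, majStep_three]
  simp

theorem wordMaj_three_five (w : ℕ → ℤ) :
    wordMaj 3 5 w = ind w 1 2 + (ind w 2 3 + ind w 1 3) +
      (ind w 3 4 + ind w 2 4 + ind w 1 4) + (ind w 4 5 + ind w 3 5 + 2 * ind w 2 5) := by
  rw [wordMaj_succ, wordMaj_three_four, majStep_three]
  simp

open Classical in
theorem ind_congr_of_eq {w w' : ℕ → ℤ} {p m : ℕ} (h0 : w' p = w p) (h1 : w' (p + 1) = w (p + 1))
    (hm : w' m = w m) : ind w' p m = ind w p m := by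
  have : Beats w' p m ↔ Beats w p m := by simp only [Beats, h0, h1, hm]
  exact if_congr (and_congr_right' this) rfl rfl

/-- Up to position `k`, where no label `m - k` exists, the steps for `k - 1` and `k` agree; beyond,
they differ by how `m` is related to the two positions that its chain starts with. -/
theorem majStep_sub (w : ℕ → ℤ) {k : ℕ} (hk : k = 2 ∨ k = 3) (m : ℕ) :
    majStep (k - 1) w m = majStep k w m +
      ((m - k : ℕ) : ℤ) * (ind w (m - k + 1) m - ind w (m - k) m) := by
  obtain h | h := Nat.lt_or_ge m k
  · rcases hk with rfl | rfl <;> interval_cases m <;>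
      simp [majStep, Finset.sum_Ico_succ_top, ind_zero]
  · obtain ⟨m, rfl⟩ := Nat.exists_eq_add_of_le' h
    rcases hk with rfl | rfl <;>
      simp [majStep, Finset.sum_Ico_succ_top] <;> ring

theorem beats_of_lt {w : ℕ → ℤ} {p q m : ℕ} (h : w p < w q) (hp : Beats w p m) : Beats w q m := by
  simp only [Beats] at hp ⊢
  omega

open Classical in
theorem ite_sub_eq_ite_sub {a b c d : Prop} (hab : b → a) (hcd : d → c)
    (h : ¬(a ↔ b) ↔ ¬(c ↔ d)) :
    (if c then (1 : ℤ) else 0) - (if a then 1 else 0) =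
      (if d then 1 else 0) - (if b then 1 else 0) := by
  by_cases a <;> by_cases b <;> by_cases c <;> by_cases d <;> simp_all

open Classical in
theorem ite_add_sub_eq_one {a b c d : Prop} (hab : b → a) (hcd : d → c)
    (h : ¬(¬(a ↔ b) ↔ ¬(c ↔ d))) :
    (if a then (1 : ℤ) else 0) + (if c then 1 else 0) - (if b then 1 else 0)
      - (if d then 1 else 0) = 1 := by
  by_cases a <;> by_cases b <;> by_cases c <;> by_cases d <;> simp_all

namespace IsContentWord
variable {n : ℕ} {w : ℕ → ℤ}

open Classical in
theorem ind_near (hw : IsContentWord n w) {p q : ℕ} (hp : 1 ≤ p) (h : p < q) (h2 : q ≤ p + 2)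
    (hq : q ≤ n) : ind w p q = if w q < w p then 1 else 0 := by
  have : w p ≠ w q := by
    obtain rfl | rfl : q = p + 1 ∨ q = p + 2 := by omega
    exacts [hw.ne_one hp hq, hw.ne_two hp hq]
  simp [ind, Beats, hp, this]

end IsContentWord

namespace IsChain

variable {n k j : ℕ} {w : ℕ → ℤ} {S : Set ℕ}

open Classical in
/-- The weighted pairs between two consecutive blocks change by exactly what the exchange of `i` and
`i + 1` does to the pair `(i, i + 1)`: this is what the splitting condition is made for. -/
theorem ind_cross (hw : IsContentWord n w) (hk : k = 2 ∨ k = 3) (h : IsChain k j w S)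
    (hw' : IsContentWord n (w ∘ interchange S)) (hj : j ≤ n) {i : ℕ} (h1 : 1 ≤ i)
    (hi : i + k ∈ S) :
    ind (w ∘ interchange S) (i + 1) (i + k) + i * ind (w ∘ interchange S) i (i + k)
      + (i + 1) * ind (w ∘ interchange S) (i + 1) (i + k + 1) + ind (w ∘ interchange S) i (i + 1)
    = ind w (i + 1) (i + k) + i * ind w i (i + k) + (i + 1) * ind w (i + 1) (i + k + 1)
      + ind w i (i + 1) := by
  have hle := h.le hi
  have hm := h.mod_eq hi
  rw [Nat.add_mod_right] at hm
  obtain ⟨s0, s0', s1, s1', -⟩ := h.interchange_apply (by omega) hm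
  obtain ⟨b, b'⟩ : (i ∈ S → (Beats (w ∘ interchange S) i (i + k) ↔ Beats w (i + 1) (i + k + 1)) ∧
      (Beats (w ∘ interchange S) i (i + k + 1) ↔ Beats w (i + 1) (i + k)) ∧
      (Beats (w ∘ interchange S) (i + 1) (i + k) ↔ Beats w i (i + k + 1)) ∧
      (Beats (w ∘ interchange S) (i + 1) (i + k + 1) ↔ Beats w i (i + k))) ∧
    (i ∉ S → (Beats (w ∘ interchange S) i (i + k) ↔ Beats w i (i + k + 1)) ∧
      (Beats (w ∘ interchange S) i (i + k + 1) ↔ Beats w i (i + k)) ∧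
      (Beats (w ∘ interchange S) (i + 1) (i + k) ↔ Beats w (i + 1) (i + k + 1)) ∧
      (Beats (w ∘ interchange S) (i + 1) (i + k + 1) ↔ Beats w (i + 1) (i + k))) := by
    rcases hk with rfl | rfl
    · exact h.beats_two hw hj h1 hi
    · exact h.beats_three hw hj h1 hi
  have c := h.next h1 hi
  rw [hw'.ind_near h1 (Nat.lt_succ_self i) (by omega) (by omega),
    hw.ind_near h1 (Nat.lt_succ_self i) (by omega) (by omega)]
  by_cases hS : i ∈ S
  · obtain ⟨b1, b2, b3, b4⟩ := b hS
    rw [ind_congr (by omega) (by omega) b1, ind_congr (by omega) h1 b3,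
      ind_congr (by omega) h1 b4]
    simp only [Function.comp_apply, s0 hS, s1 hS]
    have H : ind w i (i + k) + ind w i (i + k + 1) - ind w (i + 1) (i + k)
        - ind w (i + 1) (i + k + 1) =
        (if w (i + 1) < w i then 1 else 0) - (if w i < w (i + 1) then 1 else 0) := by
      have c := c.1 hS
      have ne := hw.ne_one h1 (by omega)
      simp only [ind, h1, Nat.le_add_left, true_and]
      simp only [Cuts] at c
      by_cases lt : w i < w (i + 1)
      · have l1 := fun m => beats_of_lt (m := m) lt
        simp only [lt, lt.not_gt, if_true, if_false]
        have := ite_add_sub_eq_one (l1 (i + k)) (l1 (i + k + 1))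
          fun e => c ((not_congr iff_comm).trans (e.trans (not_congr iff_comm)))
        linarith
      · have lt' : w (i + 1) < w i := by omega
        have l1 := fun m => beats_of_lt (m := m) lt'
        simp only [lt, lt', if_true, if_false]
        rw [sub_zero]
        exact ite_add_sub_eq_one (l1 (i + k)) (l1 (i + k + 1)) c
    linear_combination H
  · obtain ⟨b1, b2, b3, b4⟩ := b' hS
    rw [ind_congr h1 h1 b1, ind_congr (by omega) (by omega) b3,
      ind_congr (by omega) (by omega) b4]
    simp only [Function.comp_apply, s0' hS, s1' hS]
    have H : ind w i (i + k + 1) - ind w i (i + k) =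
        ind w (i + 1) (i + k + 1) - ind w (i + 1) (i + k) := by
      simp only [hS, false_iff, not_not, Cuts] at c
      simp only [ind, h1, Nat.le_add_left, true_and]
      rcases (hw.ne_one h1 (by omega)).lt_or_gt with lt | lt
      · exact (ite_sub_eq_ite_sub (beats_of_lt lt) (beats_of_lt lt)
          ((not_congr iff_comm).trans (c.trans (not_congr iff_comm)))).symm
      · exact ite_sub_eq_ite_sub (beats_of_lt lt) (beats_of_lt lt) c
    linear_combination i * H

theorem comp_of_notMem (h : IsChain k j w S) (hk : k = 2 ∨ k = 3) {i : ℕ} (hi : i % k = j % k)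
    (hS : i ∉ S) {a : ℕ} (h1 : i ≤ a) (h2 : a < i + k) : (w ∘ interchange S) a = w a := by
  obtain ⟨-, s0, -, s1, s2⟩ := h.interchange_apply (by omega) hi
  obtain rfl | rfl | ⟨rfl, h3⟩ : a = i ∨ a = i + 1 ∨ a = i + 2 ∧ 3 ≤ k := by omega
  exacts [congrArg w (s0 hS), congrArg w (s1 hS), congrArg w (s2 h3)]

/-- The exchange fixes the positions below the lowest block of the residue class. -/
theorem comp_of_lt (h : IsChain k j w S) (hk : k = 2 ∨ k = 3) {i : ℕ} (hi : i % k = j % k)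
    (hik : i ≤ k) {a : ℕ} (h2 : a < i) : (w ∘ interchange S) a = w a := by
  have out : ∀ b, b < i → b ∉ S := fun b hb hS => by
    have h3 := h.pos hS
    have h4 := h.mod_eq hS
    rw [← hi, Nat.mod_eq_of_lt (by omega)] at h4
    rcases hik.lt_or_eq with h5 | rfl
    · rw [Nat.mod_eq_of_lt h5] at h4
      omega
    · rw [Nat.mod_self] at h4
      omega
  exact congrArg w (interchange_of_notMem (out a h2) (out (a - 1) (by omega)))

/-- The effect of the exchange on a prefix that ends just before position `i + k`, for `i` in the
residue class of the chain: the only pair whose contribution is not balanced is `(i, i + 1)`. -/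
theorem wordMaj_two (hw : IsContentWord n w) (h : IsChain 2 j w S)
    (hw' : IsContentWord n (w ∘ interchange S)) (hj : j ≤ n) (i : ℕ) (h1 : 1 ≤ i)
    (hm : i % 2 = j % 2) (hi : i + 2 ≤ j) :
    wordMaj 2 (i + 1) (w ∘ interchange S) - wordMaj 2 (i + 1) w =
      ind (w ∘ interchange S) i (i + 1) - ind w i (i + 1) := by
  induction i using Nat.strong_induction_on with
  | _ i ih =>
  obtain ⟨s0, -, s1, -, -⟩ := h.interchange_apply le_rfl hm
  have f0 := fun a hS => h.comp_of_notMem (Or.inl rfl) hm (a := a) hS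
  have f1 := fun a hi => h.comp_of_lt (Or.inl rfl) hm (a := a) hi
  obtain rfl | rfl | ⟨i, hi0, rfl⟩ : i = 1 ∨ i = 2 ∨ ∃ p, 1 ≤ p ∧ i = p + 2 := by
    rcases Nat.lt_or_ge i 3 with h | h
    · omega
    · exact Or.inr (Or.inr ⟨i - 2, by omega, by omega⟩)
  · rw [wordMaj_two_two, wordMaj_two_two]
  · rw [wordMaj_two_three, wordMaj_two_three]
    have e1 := f1 1 le_rfl (by omega)
    by_cases hS : 2 ∈ S
    · have a1 := hw.ind_near le_rfl (q := 2) (by omega) (by omega) (by omega)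
      have a2 := hw.ind_near le_rfl (q := 3) (by omega) (by omega) (by omega)
      have b1 := hw'.ind_near le_rfl (q := 2) (by omega) (by omega) (by omega)
      have b2 := hw'.ind_near le_rfl (q := 3) (by omega) (by omega) (by omega)
      rw [e1] at b1 b2
      simp only [Function.comp_apply, s0 hS, s1 hS, Nat.reduceAdd] at b1 b2 s1
      rw [a1, a2, b1, b2]
      ring
    · have e2 := f0 2 hS le_rfl (by omega)
      have e3 := f0 3 hS (by omega) (by omega)
      rw [ind_congr_of_eq (p := 1) e1 e2 e2, ind_congr_of_eq (p := 1) e1 e2 e3]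
      ring
  · have hm' : i % 2 = j % 2 := by omega
    have ih := ih i (by omega) hi0 hm' (by omega)
    have e1 := majStep_two w i
    have e2 := majStep_two w (i + 1)
    have e1' := majStep_two (w ∘ interchange S) i
    have e2' := majStep_two (w ∘ interchange S) (i + 1)
    have e3 := wordMaj_succ 2 (i + 1) w
    have e4 := wordMaj_succ 2 (i + 2) w
    have e3' := wordMaj_succ 2 (i + 1) (w ∘ interchange S)
    have e4' := wordMaj_succ 2 (i + 2) (w ∘ interchange S)
    simp only [add_assoc, Nat.reduceAdd] at *
    rw [e4, e3, e4', e3', e1, e2, e1', e2']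
    push_cast
    by_cases hS : i + 2 ∈ S
    · have c := h.ind_cross hw (Or.inl rfl) hw' hj hi0 hS
      simp only [add_assoc, Nat.reduceAdd] at c
      linear_combination ih + c
    · have hS' : i ∉ S := fun hS' => (h.up hS').elim (by omega) hS
      have f2 := fun a => h.comp_of_notMem (Or.inl rfl) hm' hS' (a := a)
      have g0 := f2 i le_rfl (by omega)
      have g1 := f2 (i + 1) (by omega) (by omega)
      have g2 := f0 (i + 2) hS le_rfl (by omega)
      have g3 := f0 (i + 3) hS (by omega) (by omega)
      rw [ind_congr_of_eq g0 g1 g1] at ih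
      rw [ind_congr_of_eq g0 g1 g2, ind_congr_of_eq g1 g2 g2, ind_congr_of_eq g1 g2 g3]
      linear_combination ih

/-- The analogue of `wordMaj_two`, with blocks of three positions. -/
theorem wordMaj_three (hw : IsContentWord n w) (h : IsChain 3 j w S)
    (hw' : IsContentWord n (w ∘ interchange S)) (hj : j ≤ n) (i : ℕ) (h1 : 1 ≤ i)
    (hm : i % 3 = j % 3) (hi : i + 3 ≤ j) :
    wordMaj 3 (i + 2) (w ∘ interchange S) - wordMaj 3 (i + 2) w =
      ind (w ∘ interchange S) i (i + 1) - ind w i (i + 1) := by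
  induction i using Nat.strong_induction_on with
  | _ i ih =>
  obtain ⟨s0, -, s1, -, s2⟩ := h.interchange_apply (by omega) hm
  have f0 := fun a hS => h.comp_of_notMem (Or.inr rfl) hm (a := a) hS
  have f1 := fun a hi => h.comp_of_lt (Or.inr rfl) hm (a := a) hi
  have near := fun p q h1 h2 h3 h4 => hw.ind_near (p := p) (q := q) h1 h2 h3 h4
  have near' := fun p q h1 h2 h3 h4 => hw'.ind_near (p := p) (q := q) h1 h2 h3 h4
  have s2 := s2 le_rfl
  obtain rfl | rfl | rfl | ⟨i, hi0, rfl⟩ :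
      i = 1 ∨ i = 2 ∨ i = 3 ∨ ∃ p, 1 ≤ p ∧ i = p + 3 := by
    rcases Nat.lt_or_ge i 4 with h | h
    · omega
    · exact Or.inr (Or.inr (Or.inr ⟨i - 3, by omega, by omega⟩))
  · rw [wordMaj_three_three, wordMaj_three_three]
    by_cases hS : 1 ∈ S
    · have s0 := s0 hS
      have s1 := s1 hS
      simp only [Nat.reduceAdd] at s0 s1 s2
      rw [near 2 3 (by omega) (by omega) (by omega) (by omega),
        near 1 3 (by omega) (by omega) (by omega) (by omega),
        near' 2 3 (by omega) (by omega) (by omega) (by omega),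
        near' 1 3 (by omega) (by omega) (by omega) (by omega)]
      simp only [Function.comp_apply, s0, s1, s2]
      ring
    · have g1 := f0 1 hS le_rfl (by omega)
      have g2 := f0 2 hS (by omega) (by omega)
      have g3 := f0 3 hS (by omega) (by omega)
      rw [ind_congr_of_eq g2 g3 g3, ind_congr_of_eq g1 g2 g3]
      ring
  · rw [wordMaj_three_four, wordMaj_three_four]
    have g1 := f1 1 (by omega) (by omega)
    by_cases hS : 2 ∈ S
    · have s0 := s0 hS
      have s1 := s1 hS
      have st := ind_congr le_rfl le_rfl (h.beats_straddle hw hj (i := 1) le_rfl hS)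
      simp only [Nat.reduceAdd] at s0 s1 s2 st
      rw [near 1 2 (by omega) (by omega) (by omega) (by omega),
        near 1 3 (by omega) (by omega) (by omega) (by omega),
        near 2 4 (by omega) (by omega) (by omega) (by omega),
        near 3 4 (by omega) (by omega) (by omega) (by omega),
        near' 1 2 (by omega) (by omega) (by omega) (by omega),
        near' 1 3 (by omega) (by omega) (by omega) (by omega),
        near' 2 4 (by omega) (by omega) (by omega) (by omega),
        near' 3 4 (by omega) (by omega) (by omega) (by omega), st, g1]
      simp only [Function.comp_apply, s0, s1, s2]
      ring
    · have g2 := f0 2 hS le_rfl (by omega)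
      have g3 := f0 3 hS (by omega) (by omega)
      have g4 := f0 4 hS (by omega) (by omega)
      rw [ind_congr_of_eq g1 g2 g2, ind_congr_of_eq g1 g2 g3, ind_congr_of_eq g1 g2 g4,
        ind_congr_of_eq g2 g3 g4, ind_congr_of_eq g3 g4 g4]
      ring
  · rw [wordMaj_three_five, wordMaj_three_five]
    have g1 := f1 1 (by omega) (by omega)
    have g2 := f1 2 (by omega) (by omega)
    rw [ind_congr_of_eq g1 g2 g2]
    by_cases hS : 3 ∈ S
    · have s0 := s0 hS
      have s1 := s1 hS
      have st := ind_congr (by omega) (by omega)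
        (h.beats_straddle hw hj (i := 2) (by omega) hS)
      simp only [Nat.reduceAdd] at s0 s1 s2 st
      -- Both pairs have weight one, `(1, 4)` as a pair at distance three with smaller element `1`.
      have x1 : ind (w ∘ interchange S) 1 3 = ind w 1 4 := ind_congr le_rfl le_rfl (by
        simp only [Beats, g1, g2, Function.comp_apply, s0, Nat.reduceAdd])
      have x2 : ind (w ∘ interchange S) 1 4 = ind w 1 3 := ind_congr le_rfl le_rfl (by
        simp only [Beats, g1, g2, Function.comp_apply, s1, Nat.reduceAdd])
      rw [x1, x2, st, near 2 3 (by omega) (by omega) (by omega) (by omega),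
        near 2 4 (by omega) (by omega) (by omega) (by omega),
        near 3 5 (by omega) (by omega) (by omega) (by omega),
        near 4 5 (by omega) (by omega) (by omega) (by omega),
        near' 2 3 (by omega) (by omega) (by omega) (by omega),
        near' 2 4 (by omega) (by omega) (by omega) (by omega),
        near' 3 5 (by omega) (by omega) (by omega) (by omega),
        near' 4 5 (by omega) (by omega) (by omega) (by omega), g2]
      simp only [Function.comp_apply, s0, s1, s2]
      ring
    · have g3 := f0 3 hS le_rfl (by omega)
      have g4 := f0 4 hS (by omega) (by omega)
      have g5 := f0 5 hS (by omega) (by omega)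
      rw [ind_congr_of_eq g1 g2 g3, ind_congr_of_eq g1 g2 g4,
        ind_congr_of_eq g2 g3 g3, ind_congr_of_eq g2 g3 g4, ind_congr_of_eq g2 g3 g5,
        ind_congr_of_eq g3 g4 g4, ind_congr_of_eq g3 g4 g5, ind_congr_of_eq g4 g5 g5]
      ring
  · have hm' : i % 3 = j % 3 := by omega
    have ih := ih i (by omega) hi0 hm' (by omega)
    have e1 := majStep_three w i
    have e2 := majStep_three w (i + 1)
    have e3 := majStep_three w (i + 2)
    have e1' := majStep_three (w ∘ interchange S) i
    have e2' := majStep_three (w ∘ interchange S) (i + 1)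
    have e3' := majStep_three (w ∘ interchange S) (i + 2)
    have e4 := wordMaj_succ 3 (i + 2) w
    have e5 := wordMaj_succ 3 (i + 3) w
    have e6 := wordMaj_succ 3 (i + 4) w
    have e4' := wordMaj_succ 3 (i + 2) (w ∘ interchange S)
    have e5' := wordMaj_succ 3 (i + 3) (w ∘ interchange S)
    have e6' := wordMaj_succ 3 (i + 4) (w ∘ interchange S)
    have t2 := (h.interchange_apply (by omega) hm').2.2.2.2 le_rfl
    simp only [add_assoc, Nat.reduceAdd] at *
    rw [e6, e5, e4, e6', e5', e4', e1, e2, e3, e1', e2', e3']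
    push_cast
    by_cases hS : i + 3 ∈ S
    · have c := h.ind_cross hw (Or.inr rfl) hw' hj hi0 hS
      have st := ind_congr (by omega) (by omega)
        (h.beats_straddle hw hj (i := i + 2) (by omega) hS)
      simp only [add_assoc, Nat.reduceAdd] at c st
      have s0 := s0 hS
      have s1 := s1 hS
      have x1 : ind (w ∘ interchange S) (i + 2) (i + 3) + ind (w ∘ interchange S) (i + 2) (i + 4)
          = ind w (i + 2) (i + 3) + ind w (i + 2) (i + 4) := by
        rw [near _ _ (by omega) (by omega) (by omega) (by omega),
          near _ _ (by omega) (by omega) (by omega) (by omega),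
          near' _ _ (by omega) (by omega) (by omega) (by omega),
          near' _ _ (by omega) (by omega) (by omega) (by omega)]
        simp only [Function.comp_apply, s0, s1, t2]
        ring
      have x2 : ind (w ∘ interchange S) (i + 3) (i + 5) + ind (w ∘ interchange S) (i + 4) (i + 5)
          = ind w (i + 3) (i + 5) + ind w (i + 4) (i + 5) := by
        rw [near _ _ (by omega) (by omega) (by omega) (by omega),
          near _ _ (by omega) (by omega) (by omega) (by omega),
          near' _ _ (by omega) (by omega) (by omega) (by omega),
          near' _ _ (by omega) (by omega) (by omega) (by omega)]
        simp only [Function.comp_apply, s0, s1, s2]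
        ring
      -- The unexchanged position of each block contributes `x1`, `x2` and `st`.
      linear_combination ih + c + x1 + x2 + (i + 2) * st
    · have hS' : i ∉ S := fun hS' => (h.up hS').elim (by omega) hS
      have f2 := fun a => h.comp_of_notMem (Or.inr rfl) hm' hS' (a := a)
      have g0 := f2 i le_rfl (by omega)
      have g1 := f2 (i + 1) (by omega) (by omega)
      have g2 := f2 (i + 2) (by omega) (by omega)
      have g3 := f0 (i + 3) hS le_rfl (by omega)
      have g4 := f0 (i + 4) hS (by omega) (by omega)
      have g5 := f0 (i + 5) hS (by omega) (by omega)
      rw [ind_congr_of_eq g0 g1 g1] at ih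
      rw [ind_congr_of_eq g0 g1 g3, ind_congr_of_eq g1 g2 g3, ind_congr_of_eq g1 g2 g4,
        ind_congr_of_eq g2 g3 g3, ind_congr_of_eq g2 g3 g4, ind_congr_of_eq g2 g3 g5,
        ind_congr_of_eq g3 g4 g4, ind_congr_of_eq g3 g4 g5, ind_congr_of_eq g4 g5 g5]
      linear_combination ih

/-- The exchange compensates for `i` and `i + 1` being related differently to `j = i + k`. -/
theorem ind_top (hw : IsContentWord n w) (hk : k = 2 ∨ k = 3) (h : IsChain k j w S)
    (hw' : IsContentWord n (w ∘ interchange S)) (hj : j ≤ n) {i : ℕ} (h1 : 1 ≤ i)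
    (e : i + k = j) (hS : i ∈ S) :
    ind (w ∘ interchange S) i (i + 1) - ind w i (i + 1) = ind w (i + 1) j - ind w i j := by
  obtain ⟨s0, -, s1, -, -⟩ := h.interchange_apply (by omega) (h.mod_eq hS)
  have c := (h.top h1 e).1 hS
  have ne := hw.ne_one h1 (by omega)
  rw [hw'.ind_near h1 (Nat.lt_succ_self i) (by omega) (by omega),
    hw.ind_near h1 (Nat.lt_succ_self i) (by omega) (by omega)]
  simp only [Function.comp_apply, s0 hS, s1 hS, ind, h1, Nat.le_add_left, true_and]
  rcases ne.lt_or_gt with lt | lt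
  · have b := beats_of_lt (m := j) lt
    have b1 : ¬Beats w i j := fun b2 => c ⟨fun _ => b b2, fun _ => b2⟩
    have b2 : Beats w (i + 1) j :=
      by_contra fun b2 => c ⟨fun h => absurd h b1, fun h => absurd h b2⟩
    simp [lt, lt.not_gt, b1, b2]
  · have b := beats_of_lt (m := j) lt
    have b1 : ¬Beats w (i + 1) j := fun b2 => c ⟨fun _ => b2, fun _ => b b2⟩
    have b2 : Beats w i j := by_contra fun b2 => c ⟨fun h => absurd h b2, fun h => absurd h b1⟩
    simp [lt, lt.not_gt, b1, b2, Nat.ne_of_gt h1]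

theorem majStep_top (hw : IsContentWord n w) (hk : k = 2 ∨ k = 3) (h : IsChain k j w S)
    (hw' : IsContentWord n (w ∘ interchange S)) (hj : j ≤ n) {i : ℕ} (h1 : 1 ≤ i)
    (e : i + k = j) :
    majStep k (w ∘ interchange S) j + (ind (w ∘ interchange S) i (i + 1) - ind w i (i + 1)) =
      majStep (k - 1) w j := by
  have sub := majStep_sub w hk j
  have hm : i % k = j % k := by rw [← e, Nat.add_mod_right]
  have ct := h.comp_top (by omega)
  rw [show j - k = i by omega] at sub
  rw [sub]
  by_cases hS : i ∈ S
  · obtain ⟨b1, b2⟩ := h.beats_top hw hk hj e hS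
    have b1 := ind_congr h1 (by omega) b1
    have b2 := ind_congr (by omega) h1 b2
    rw [h.ind_top hw hk hw' hj h1 e hS]
    subst e
    rcases hk with rfl | rfl
    · rw [majStep_two, majStep_two, b1, b2]
      ring
    · have s2 := (h.interchange_apply (by omega) hm).2.2.2.2 le_rfl
      have b3 : ind (w ∘ interchange S) (i + 2) (i + 3) = ind w (i + 2) (i + 3) := by
        rw [hw'.ind_near (by omega) (by omega) (by omega) (by omega),
          hw.ind_near (by omega) (by omega) (by omega) (by omega), ct]
        simp only [Function.comp_apply, s2]
      rw [majStep_three, majStep_three, b1, b2, b3]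
      ring
  · have c : ind w (i + 1) j = ind w i j := by
      have c := (not_congr (h.top h1 e)).1 hS
      rw [Cuts, not_not] at c
      exact ind_congr (by omega) h1 c.symm
    have f := fun a => h.comp_of_notMem hk hm hS (a := a)
    have g0 := f i le_rfl (by omega)
    have g1 := f (i + 1) (by omega) (by omega)
    rw [ind_congr_of_eq g0 g1 g1, c]
    subst e
    rcases hk with rfl | rfl
    · rw [majStep_two, majStep_two, ind_congr_of_eq g1 ct ct, ind_congr_of_eq g0 g1 ct]
      ring
    · have g2 := f (i + 2) (by omega) (by omega)
      rw [majStep_three, majStep_three, ind_congr_of_eq g2 ct ct, ind_congr_of_eq g1 g2 ct,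
        ind_congr_of_eq g0 g1 ct]
      ring

/-- Adding the letter `j` and exchanging along its chain raises the `k`-major index of the first
`j - 1` letters by what the letter `j` contributes to the `(k - 1)`-major index. -/
theorem wordMaj_comp (hw : IsContentWord n w) (hk : k = 2 ∨ k = 3) (h : IsChain k j w S)
    (hw' : IsContentWord n (w ∘ interchange S)) (hj : j ≤ n) (hj1 : 1 ≤ j) :
    wordMaj k j (w ∘ interchange S) = wordMaj k (j - 1) w + majStep (k - 1) w j := by
  rcases Nat.lt_or_ge k j with hkj | hkj
  · obtain ⟨i, h1, rfl⟩ : ∃ i, 1 ≤ i ∧ j = i + k := ⟨j - k, by omega, by omega⟩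
    have top := h.majStep_top hw hk hw' hj h1 rfl
    have pre : wordMaj k (i + k - 1) (w ∘ interchange S) - wordMaj k (i + k - 1) w =
        ind (w ∘ interchange S) i (i + 1) - ind w i (i + 1) := by
      have hm : i % k = (i + k) % k := (Nat.add_mod_right i k).symm
      rcases hk with rfl | rfl
      · exact h.wordMaj_two hw hw' hj i h1 hm le_rfl
      · exact h.wordMaj_three hw hw' hj i h1 hm le_rfl
    have suc := wordMaj_succ k (i + k - 1) (w ∘ interchange S)
    rw [Nat.sub_add_cancel hj1] at suc
    rw [suc]
    linear_combination pre + top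
  · have hS : S = ∅ := by
      refine Set.eq_empty_of_forall_notMem fun i hi => ?_
      have h1 := h.pos hi
      have h2 := h.le hi
      omega
    have hid : w ∘ interchange S = w := by
      funext a
      simp [hS, interchange]
    have sub := majStep_sub w hk j
    rw [Nat.sub_eq_zero_of_le hkj, Nat.cast_zero, zero_mul, add_zero] at sub
    have suc := wordMaj_succ k (j - 1) w
    rw [Nat.sub_add_cancel hj1] at suc
    rw [hid, sub, suc]

end IsChain

/-! ### Standard tableaux and their content words -/

section Tableaux

variable {μ : YoungDiagram} {T : ℕ × ℕ → ℕ}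

theorem cell_mem_apply (hT : T ∈ SYT μ) {a : ℕ} (h1 : 1 ≤ a) (hn : a ≤ μ.card) :
    cell T a ∈ μ ∧ T (cell T a) = a := by
  obtain ⟨c, hc, rfl⟩ := hT.1.2.2 (show a ∈ Set.Icc 1 μ.card from ⟨h1, hn⟩)
  have e : T (cell T (T c)) = T c := Function.invFun_eq ⟨c, rfl⟩
  refine ⟨?_, e⟩
  by_contra hc'
  rw [hT.2.1 _ hc'] at e
  omega

theorem apply_bounds (hT : T ∈ SYT μ) {c : ℕ × ℕ} (hc : c ∈ μ) : 1 ≤ T c ∧ T c ≤ μ.card :=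
  hT.1.1 ((YoungDiagram.mem_cells _).2 hc)

theorem eq_of_apply_eq (hT : T ∈ SYT μ) {c d : ℕ × ℕ} (hc : c ∈ μ) (h : T c = T d) : c = d := by
  have hd : d ∈ μ := by
    by_contra hd
    have := apply_bounds hT hc
    rw [h, hT.2.1 d hd] at this
    omega
  exact hT.1.2.1 ((YoungDiagram.mem_cells _).2 hc) ((YoungDiagram.mem_cells _).2 hd) h

theorem cell_apply (hT : T ∈ SYT μ) {c : ℕ × ℕ} (hc : c ∈ μ) : cell T (T c) = c :=
  (eq_of_apply_eq hT hc (Function.invFun_eq (f := T) ⟨c, rfl⟩).symm).symm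

theorem apply_lt (hT : T ∈ SYT μ) {r c r' c' : ℕ} (hr : r ≤ r') (hc : c ≤ c')
    (hne : r < r' ∨ c < c') (hm : (r', c') ∈ μ) : T (r, c) < T (r', c') := by
  have hm' : (r, c') ∈ μ := μ.up_left_mem hr le_rfl hm
  rcases hr.lt_or_eq with h | rfl
  · have h2 := hT.2.2.2 r r' c' h hm
    rcases hc.lt_or_eq with h' | rfl
    · exact (hT.2.2.1 r c c' h' hm').trans h2
    · exact h2
  · exact hT.2.2.1 r c c' (by omega) hm

/-- The content word of a tableau: its `i`-th letter is the content (column minus row) of the cell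
with label `i`. -/
noncomputable def contentWord (T : ℕ × ℕ → ℕ) (i : ℕ) : ℤ := (cell T i).2 - (cell T i).1

theorem contentWord_apply (hT : T ∈ SYT μ) {r c : ℕ} (hc : (r, c) ∈ μ) :
    contentWord T (T (r, c)) = (c : ℤ) - r := by
  simp [contentWord, cell_apply hT hc]

theorem isContentWord (hT : T ∈ SYT μ) : IsContentWord μ.card (contentWord T) := by
  intro i m h1 him hm e
  obtain ⟨ci, ei⟩ := cell_mem_apply hT h1 (by omega)
  obtain ⟨cm, em⟩ := cell_mem_apply hT (a := m) (by omega) hm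
  simp only [contentWord] at e
  obtain ⟨r, c, hci⟩ : ∃ r c, cell T i = (r, c) := ⟨_, _, rfl⟩
  obtain ⟨r', c', hcm⟩ : ∃ r c, cell T m = (r, c) := ⟨_, _, rfl⟩
  rw [hci] at ci ei
  rw [hcm] at cm em
  simp only [hci, hcm] at e
  have hr : r < r' := by
    by_contra hr
    rcases (show r' ≤ r by omega).lt_or_eq with h | h
    · have := apply_lt hT h.le (show c' ≤ c by omega) (Or.inl h) ci
      omega
    · have hc : c = c' := by omega
      subst h hc
      omega
  have hup : (r + 1, c) ∈ μ := μ.up_left_mem (by omega) (by omega) cm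
  have hri : (r, c + 1) ∈ μ := μ.up_left_mem (by omega) (by omega) cm
  refine ⟨⟨T (r, c + 1), ?_, ?_, ?_⟩, ⟨T (r + 1, c), ?_, ?_, ?_⟩⟩
  · rw [← ei]; exact apply_lt hT le_rfl (by omega) (by omega) hri
  · rw [← em]; exact apply_lt hT (by omega) (by omega) (by omega) cm
  · rw [contentWord_apply hT hri, contentWord, hci]; push_cast; ring
  · rw [← ei]; exact apply_lt hT (by omega) le_rfl (by omega) hup
  · rw [← em]; exact apply_lt hT (by omega) (by omega) (by omega) cm
  · rw [contentWord_apply hT hup, contentWord, hci]; push_cast; ring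

/-- Labels at distance at most `4` in strict southwest-northeast position occupy opposite corners of
a `2 × 2` square: any larger rectangle would need more labels in between. -/
theorem contentWord_eq_of_southwest (hT : T ∈ SYT μ) {i m : ℕ} (h1 : 1 ≤ i) (him : i < m)
    (hm : m ≤ μ.card) (h4 : m ≤ i + 4) (south : (cell T i).1 < (cell T m).1)
    (west : (cell T i).2 < (cell T m).2) :
    contentWord T i = contentWord T m := by
  obtain ⟨cm, em⟩ := cell_mem_apply hT (a := m) (by omega) hm
  obtain ⟨ci, ei⟩ := cell_mem_apply hT h1 (him.le.trans hm)
  simp only [contentWord]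
  obtain ⟨r, c, hci⟩ : ∃ r c, cell T i = (r, c) := ⟨_, _, rfl⟩
  obtain ⟨r', c', hcm⟩ : ∃ r c, cell T m = (r, c) := ⟨_, _, rfl⟩
  rw [hci] at ci ei
  rw [hcm] at cm em
  simp only [hci, hcm] at south west ⊢
  have h10 : (r + 1, c) ∈ μ := μ.up_left_mem (by omega) (by omega) cm
  have h01 : (r, c + 1) ∈ μ := μ.up_left_mem (by omega) (by omega) cm
  have h11 : (r + 1, c + 1) ∈ μ := μ.up_left_mem (by omega) (by omega) cm
  have l1 := apply_lt hT (Nat.le_add_right r 1) (le_refl c) (Or.inl (Nat.lt_add_one r)) h10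
  have l2 := apply_lt hT (le_refl r) (Nat.le_add_right c 1) (Or.inr (Nat.lt_add_one c)) h01
  have l3 := apply_lt hT (le_refl (r + 1)) (Nat.le_add_right c 1) (Or.inr (Nat.lt_add_one c)) h11
  have l4 := apply_lt hT (Nat.le_add_right r 1) (le_refl (c + 1)) (Or.inl (Nat.lt_add_one r)) h11
  -- The three other cells of the square already carry labels; a larger rectangle adds a fourth one
  -- strictly between `i` and `m`.
  have n1 : T (r + 1, c) ≠ T (r, c + 1) := fun e => by
    simpa using eq_of_apply_eq hT h10 e
  have hr : r' = r + 1 := by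
    by_contra hr
    have h20 : (r + 2, c) ∈ μ := μ.up_left_mem (by omega) (by omega) cm
    have l5 := apply_lt hT (show r + 1 ≤ r + 2 by omega) (le_refl c) (Or.inl (Nat.lt_add_one _)) h20
    have l6 := apply_lt hT (show r + 2 ≤ r' by omega) west.le (Or.inr west) cm
    have l7 := apply_lt hT (show r + 1 ≤ r' by omega) (show c + 1 ≤ c' by omega)
      (Or.inl (by omega)) cm
    have n2 : T (r + 2, c) ≠ T (r, c + 1) := fun e => by simpa using eq_of_apply_eq hT h20 e
    have n3 : T (r + 2, c) ≠ T (r + 1, c + 1) := fun e => by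
      simpa using eq_of_apply_eq hT h20 e
    omega
  have hc : c' = c + 1 := by
    by_contra hc
    have h02 : (r, c + 2) ∈ μ := μ.up_left_mem (by omega) (by omega) cm
    have l5 := apply_lt hT (le_refl r) (show c + 1 ≤ c + 2 by omega) (Or.inr (Nat.lt_add_one _)) h02
    have l6 := apply_lt hT south.le (show c + 2 ≤ c' by omega) (Or.inl south) cm
    have l7 := apply_lt hT (show r + 1 ≤ r' by omega) (show c + 1 ≤ c' by omega)
      (Or.inr (by omega)) cm
    have n2 : T (r + 1, c) ≠ T (r, c + 2) := fun e => by simpa using eq_of_apply_eq hT h10 e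
    have n3 : T (r + 1, c + 1) ≠ T (r, c + 2) := fun e => by
      simpa using eq_of_apply_eq hT h11 e
    omega
  subst hr hc
  push_cast
  ring

/-- A smaller label is never weakly northeast of a larger one. -/
theorem not_northeast (hT : T ∈ SYT μ) {i m : ℕ} (h1 : 1 ≤ i) (him : i < m) (hm : m ≤ μ.card) :
    ¬((cell T m).1 ≤ (cell T i).1 ∧ (cell T m).2 ≤ (cell T i).2) := by
  rintro ⟨hr, hc⟩
  obtain ⟨cm, em⟩ := cell_mem_apply hT (a := m) (by omega) hm
  obtain ⟨ci, ei⟩ := cell_mem_apply hT h1 (him.le.trans hm)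
  rcases hr.lt_or_eq with h | h
  · have : T (cell T m) < T (cell T i) := apply_lt hT hr hc (Or.inl h) ci
    omega
  · rcases hc.lt_or_eq with h' | h'
    · have : T (cell T m) < T (cell T i) := apply_lt hT hr hc (Or.inr h') ci
      omega
    · rw [Prod.ext h h', ei] at em
      omega

theorem attacks_of_contentWord_lt (hT : T ∈ SYT μ) {i m : ℕ} (h1 : 1 ≤ i) (him : i < m)
    (hm : m ≤ μ.card) (h4 : m ≤ i + 4) (h : contentWord T m < contentWord T i) :
    Attacks T i m := by
  have ne := not_northeast hT h1 him hm
  have sw := contentWord_eq_of_southwest hT h1 him hm h4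
  simp only [contentWord] at h sw
  exact .southeast him (by omega) (by omega)

theorem attacks_iff_beats (hT : T ∈ SYT μ) {i m : ℕ} (h1 : 1 ≤ i) (him : i < m)
    (hm : m ≤ μ.card) (h4 : m ≤ i + 4) : Attacks T i m ↔ Beats (contentWord T) i m := by
  constructor
  · intro h
    induction h with
    | southeast lt south east => left; simp only [contentWord]; omega
    | @southwest i m lt south west next ih =>
      have e := contentWord_eq_of_southwest hT h1 him hm h4 south west
      have lt' : i + 1 < m := by cases next <;> assumption
      have ne := (isContentWord hT).ne_one h1 (by omega)
      have := ih (by omega) lt' hm (by omega)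
      simp only [Beats] at *
      omega
  · rintro (h | ⟨e, h⟩)
    · exact attacks_of_contentWord_lt hT h1 him hm h4 h
    · have lt' : i + 1 < m := by
        by_contra hlt
        obtain rfl : m = i + 1 := by omega
        exact lt_irrefl _ h
      have ne := not_northeast hT h1 him hm
      have next := attacks_of_contentWord_lt hT (by omega) lt' hm (by omega) h
      simp only [contentWord] at e
      exact .southwest him (by omega) (by omega) next

/-- If no two elements of `S` are consecutive, `interchange S` is an involution. -/
theorem interchange_interchange {S : Set ℕ} (hS : ∀ i ∈ S, i + 1 ∉ S) (a : ℕ) :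
    interchange S (interchange S a) = a := by
  by_cases h : a ∈ S
  · simp [interchange, h, hS a h]
  · by_cases h' : 1 ≤ a ∧ a - 1 ∈ S
    · simp only [interchange, h, h', if_false, and_self, if_true]
      omega
    · simp [interchange, h, h']

theorem interchange_lt {S : Set ℕ} (hS : ∀ i ∈ S, i + 1 ∉ S) {a b : ℕ} (hab : a < b)
    (h : ¬(a ∈ S ∧ b = a + 1)) : interchange S a < interchange S b := by
  have e1 : a ∈ S → b ≠ a + 1 := fun ha hb => h ⟨ha, hb⟩
  have e2 : a ∈ S → b - 1 ∈ S → b - 1 ≠ a + 1 := fun ha hb e => hS a ha (e ▸ hb)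
  have e3 : a ∉ S → b - 1 ∈ S → b - 1 ≠ a := fun ha hb e => ha (e ▸ hb)
  unfold interchange
  grind

/-- Exchanging labels `i` and `i + 1` in cells that are not adjacent gives a standard tableau. -/
theorem interchange_comp_mem (hT : T ∈ SYT μ) {S : Set ℕ} (pos : ∀ i ∈ S, 1 ≤ i)
    (le : ∀ i ∈ S, i + 1 ≤ μ.card) (hS : ∀ i ∈ S, i + 1 ∉ S)
    (apart : ∀ i ∈ S, contentWord T i + 2 ≤ contentWord T (i + 1) ∨
      contentWord T (i + 1) + 2 ≤ contentWord T i) :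
    (fun c => interchange S (T c)) ∈ SYT μ := by
  have maps : ∀ a, 1 ≤ a → a ≤ μ.card →
      1 ≤ interchange S a ∧ interchange S a ≤ μ.card := by
    intro a h1 hn
    by_cases h : a ∈ S
    · simp [interchange, h, le a h]
    · by_cases h' : 1 ≤ a ∧ a - 1 ∈ S
      · have := pos _ h'.2
        simp only [interchange, h, h', if_false, and_self, if_true]
        omega
      · simp only [interchange, h, h', if_false]
        exact ⟨h1, hn⟩
  have bij : Set.BijOn (interchange S) (Set.Icc 1 μ.card) (Set.Icc 1 μ.card) :=
    Set.InvOn.bijOn ⟨fun a _ => interchange_interchange hS a,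
      fun a _ => interchange_interchange hS a⟩ (fun a h => maps a h.1 h.2)
      (fun a h => maps a h.1 h.2)
  have swap : ∀ c d : ℕ × ℕ, d ∈ μ → T c < T d → c ∈ μ →
      (contentWord T (T c) < contentWord T (T d) + 2 ∧
        contentWord T (T d) < contentWord T (T c) + 2 ∨ T c + 1 < T d) →
      interchange S (T c) < interchange S (T d) := by
    intro c d hd hlt hc hcd
    refine interchange_lt hS hlt ?_
    rintro ⟨hS, e⟩
    have := apart _ hS
    rw [← e] at this
    omega
  refine ⟨bij.comp hT.1, fun c hc => ?_, fun r c₁ c₂ h hm => ?_, fun r₁ r₂ c h hm => ?_⟩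
  · have h0 : 0 ∉ S := fun h => absurd (pos 0 h) (by omega)
    simp [hT.2.1 c hc, interchange, h0]
  · have hm' : (r, c₁ + 1) ∈ μ := μ.up_left_mem le_rfl h hm
    have hm1 : (r, c₁) ∈ μ := μ.up_left_mem le_rfl h.le hm
    have l1 := hT.2.2.1 r c₁ (c₁ + 1) (by omega) hm'
    refine swap _ _ hm (hT.2.2.1 r c₁ c₂ h hm) hm1 ?_
    rcases (show c₁ + 1 ≤ c₂ from h).lt_or_eq with h' | rfl
    · right
      have l2 := hT.2.2.1 r (c₁ + 1) c₂ h' hm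
      omega
    · left
      rw [contentWord_apply hT hm, contentWord_apply hT hm1]
      push_cast
      omega
  · have hm' : (r₁ + 1, c) ∈ μ := μ.up_left_mem h le_rfl hm
    have hm1 : (r₁, c) ∈ μ := μ.up_left_mem h.le le_rfl hm
    have l1 := hT.2.2.2 r₁ (r₁ + 1) c (by omega) hm'
    refine swap _ _ hm (hT.2.2.2 r₁ r₂ c h hm) hm1 ?_
    rcases (show r₁ + 1 ≤ r₂ from h).lt_or_eq with h' | rfl
    · right
      have l2 := hT.2.2.2 (r₁ + 1) r₂ c h' hm
      omega
    · left
      rw [contentWord_apply hT hm, contentWord_apply hT hm1]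
      push_cast
      omega

/-- This holds for all positions: if a label does not occur, `cell` takes the same default value on
both sides. -/
theorem contentWord_interchange (T : ℕ × ℕ → ℕ) {S : Set ℕ} (hS : ∀ i ∈ S, i + 1 ∉ S) :
    contentWord (fun c => interchange S (T c)) = contentWord T ∘ interchange S := by
  funext a
  have e : (fun c => interchange S (T c) = a) = fun c => T c = interchange S a := by
    funext c
    refine propext ⟨fun h => ?_, fun h => ?_⟩
    · rw [← h, interchange_interchange hS]
    · rw [h, interchange_interchange hS]
  have : cell (fun c => interchange S (T c)) a = cell T (interchange S a) := by
    exact congrArg (fun P : ℕ × ℕ → Prop => @dite _ (∃ x, P x) (Classical.propDecidable _)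
      (fun h => h.choose) fun _ => Classical.arbitrary _) e
  simp only [contentWord, this, Function.comp_apply]

end Tableaux

/-! ### The maps `γ` and `Φ` -/

variable {μ : YoungDiagram} {T : ℕ × ℕ → ℕ} {k j : ℕ}

theorem MemΓ.pos {i : ℕ} (h : MemΓ k j T i) : 1 ≤ i := by
  cases h <;> assumption

theorem MemΓ.le {i : ℕ} (h : MemΓ k j T i) : i + k ≤ j := by
  induction h with
  | base _ eq _ => exact eq.le
  | step _ _ _ ih => omega

theorem splits_iff_cuts (hT : T ∈ SYT μ) {i m : ℕ} (h1 : 1 ≤ i) (him : i + 1 < m)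
    (hm : m ≤ μ.card) (h4 : m ≤ i + 4) :
    Splits T m i (i + 1) ↔ Cuts (contentWord T) m i (i + 1) := by
  rw [Splits, Cuts, attacks_iff_beats hT h1 (by omega) hm h4,
    attacks_iff_beats hT (by omega) him hm (by omega), xor_iff_not_iff]

theorem isChain_setOf_memΓ (hT : T ∈ SYT μ) (hk : k = 2 ∨ k = 3) (hj : j ≤ μ.card) :
    IsChain k j (contentWord T) {i | MemΓ k j T i} where
  pos_step := by omega
  pos := MemΓ.pos
  le := MemΓ.le
  top := by
    rintro i h1 rfl
    rw [← splits_iff_cuts hT h1 (by omega) hj (by omega)]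
    refine ⟨fun h => ?_, fun h => MemΓ.base h1 rfl h⟩
    cases h with
    | base _ _ s => exact s
    | step _ h _ => have := h.le; omega
  next := by
    intro i h1 hS
    have hle := MemΓ.le hS
    rw [← splits_iff_cuts hT h1 (by omega) (by omega) (by omega),
      ← splits_iff_cuts hT h1 (by omega) (by omega) (by omega), ← xor_iff_not_iff]
    refine ⟨fun h => ?_, fun h => MemΓ.step h1 hS h⟩
    cases h with
    | base _ e _ => omega
    | step _ _ s => exact s
  up := by
    intro i h
    cases h with
    | base _ e _ => exact Or.inl e
    | step _ h _ => exact Or.inr h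

theorem memΓ_succ (hT : T ∈ SYT μ) (hk : k = 2 ∨ k = 3) (hj : j ≤ μ.card) :
    ∀ i ∈ {i | MemΓ k j T i}, i + 1 ∉ {i | MemΓ k j T i} := by
  intro i hi hi'
  have h := isChain_setOf_memΓ hT hk hj
  have h1 := h.mod_eq hi
  have h2 := h.mod_eq hi'
  rcases hk with rfl | rfl <;> omega

theorem γ_mem (hT : T ∈ SYT μ) (hk : k = 2 ∨ k = 3) (hj : j ≤ μ.card) : γ k j T ∈ SYT μ := by
  have h := isChain_setOf_memΓ hT hk hj
  refine interchange_comp_mem hT (fun i hi => h.pos hi) (fun i hi => ?_) (memΓ_succ hT hk hj)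
    fun i hi => ?_
  · have := h.le hi
    omega
  · rcases hk with rfl | rfl
    · exact h.apart_two (isContentWord hT) hj hi
    · exact h.apart_three (isContentWord hT) hj hi

theorem contentWord_γ (hT : T ∈ SYT μ) (hk : k = 2 ∨ k = 3) (hj : j ≤ μ.card) :
    contentWord (γ k j T) = contentWord T ∘ interchange {i | MemΓ k j T i} :=
  contentWord_interchange T (memΓ_succ hT hk hj)

theorem γ_γ (hT : T ∈ SYT μ) (hk : k = 2 ∨ k = 3) (hj : j ≤ μ.card) : γ k j (γ k j T) = T := by
  have h := (isChain_setOf_memΓ hT hk hj).comp_interchange (isContentWord hT) hk hj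
  have h' := isChain_setOf_memΓ (γ_mem hT hk hj) hk hj
  rw [contentWord_γ hT hk hj] at h'
  have e := h'.unique h (fun _ _ _ => Iff.rfl) (fun _ _ _ => Iff.rfl)
  funext c
  rw [γ, e]
  exact interchange_interchange (memΓ_succ hT hk hj) (T c)

theorem γ_bijOn (hk : k = 2 ∨ k = 3) (hj : j ≤ μ.card) : Set.BijOn (γ k j) (SYT μ) (SYT μ) :=
  Set.InvOn.bijOn ⟨fun _ hT => γ_γ hT hk hj, fun _ hT => γ_γ hT hk hj⟩
    (fun _ hT => γ_mem hT hk hj) (fun _ hT => γ_mem hT hk hj)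

theorem Φ_bijOn (hk : k = 2 ∨ k = 3) {m : ℕ} (hm : m ≤ μ.card) :
    Set.BijOn (Φ k m) (SYT μ) (SYT μ) := by
  induction m with
  | zero => exact Set.bijOn_id _
  | succ m ih => exact (γ_bijOn hk hm).comp (ih (by omega))

/-- Only the labels up to `j - k + 1` are moved by `γ k j`. -/
theorem contentWord_γ_apply (hT : T ∈ SYT μ) (hk : k = 2 ∨ k = 3) (hj : j ≤ μ.card) {a : ℕ}
    (ha : j + 1 < a + k) : contentWord (γ k j T) a = contentWord T a := by
  have out : ∀ b, j < b + k → b ∉ {i | MemΓ k j T i} := fun b hb hi => by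
    have := MemΓ.le hi
    omega
  rw [contentWord_γ hT hk hj, Function.comp_apply,
    interchange_of_notMem (out a (by omega)) (out (a - 1) (by omega))]

/-- The maps up to `γ k m` do not move the labels that `m + 1` is compared with in the
`(k - 1)`-major index. -/
theorem contentWord_Φ_apply (hT : T ∈ SYT μ) (hk : k = 2 ∨ k = 3) {m : ℕ} (hm : m ≤ μ.card)
    {a : ℕ} (ha : m + 1 < a + k) : contentWord (Φ k m T) a = contentWord T a := by
  induction m with
  | zero => rfl
  | succ m ih =>
    rw [Φ, contentWord_γ_apply ((Φ_bijOn hk (by omega)).mapsTo hT) hk hm ha]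
    exact ih (by omega) (by omega)

theorem majStep_congr {w w' : ℕ → ℤ} {m : ℕ} (h : ∀ a, m ≤ a + k → w' a = w a) :
    majStep k w' m = majStep k w m := by
  have key : ∀ d, d ≤ k → ind w' (m - d) m = ind w (m - d) m := by
    intro d hd
    rcases Nat.eq_zero_or_pos (m - d) with e | e
    · rw [e, ind_zero, ind_zero]
    · exact ind_congr_of_eq (h _ (by omega)) (h _ (by omega)) (h _ (by omega))
  rw [majStep, majStep, key k le_rfl]
  congr 1
  refine Finset.sum_congr rfl fun d hd => key d ?_
  have := Finset.mem_Ico.1 hd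
  omega

theorem wordMaj_Φ (hT : T ∈ SYT μ) (hk : k = 2 ∨ k = 3) {m : ℕ} (hm : m ≤ μ.card) :
    wordMaj k m (contentWord (Φ k m T)) = wordMaj (k - 1) m (contentWord T) := by
  induction m with
  | zero => rfl
  | succ m ih =>
    have hU := (Φ_bijOn hk (show m ≤ μ.card by omega)).mapsTo hT
    have hw' := isContentWord (γ_mem hU hk hm)
    rw [contentWord_γ hU hk hm] at hw'
    have := (isChain_setOf_memΓ hU hk hm).wordMaj_comp (isContentWord hU) hk hw' hm (by omega)
    rw [Φ, contentWord_γ hU hk hm, this, Nat.add_sub_cancel, ih (by omega), wordMaj_succ]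
    congr 1
    refine majStep_congr fun a ha => contentWord_Φ_apply hT hk (by omega) ?_
    omega

/-- A sum over the `d`-descents as a sum over their larger elements `m + 1`. -/
theorem sum_Des (hT : T ∈ SYT μ) {d : ℕ} (h1 : 1 ≤ d) (h4 : d ≤ 4) (f : ℕ → ℤ) :
    ∑ p ∈ Des μ.card d T, f p.1 =
      ∑ m ∈ Finset.range μ.card, f (m + 1 - d) * ind (contentWord T) (m + 1 - d) (m + 1) := by
  classical
  have h0 : Finset.Icc 1 μ.card = Finset.Ico 1 (μ.card + 1) := rfl
  rw [Des, Finset.sum_filter, Finset.sum_product_right]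
  nth_rewrite 1 [h0]
  rw [Finset.sum_Ico_eq_sum_range, Nat.add_sub_cancel]
  refine Finset.sum_congr rfl fun m hm => ?_
  have hm := Finset.mem_range.1 hm
  rw [add_comm 1 m]
  rcases Nat.eq_zero_or_pos (m + 1 - d) with e | e
  · rw [e, ind_zero, mul_zero]
    refine Finset.sum_eq_zero fun x hx => if_neg fun c => ?_
    have := (Finset.mem_Icc.1 hx).1
    omega
  · rw [Finset.sum_eq_single (m + 1 - d)]
    · have := attacks_iff_beats hT e (m := m + 1) (by omega) (by omega) (by omega)
      have e' : m + 1 = m + 1 - d + d := by omega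
      simp only [← e', this, true_and, ind, show 1 ≤ m + 1 - d from e]
      split_ifs <;> simp
    · intro x _ hx
      exact if_neg fun c => by omega
    · intro hx
      exact absurd (Finset.mem_Icc.2 ⟨e, by omega⟩) hx

open Classical in
theorem maj_eq_wordMaj (hT : T ∈ SYT μ) (h1 : 1 ≤ k) (h4 : k ≤ 4) :
    (maj μ.card k T : ℤ) = wordMaj k μ.card (contentWord T) := by
  have card : ∀ d, 1 ≤ d → d ≤ 4 → ((Des μ.card d T).card : ℤ) =
      ∑ m ∈ Finset.range μ.card, ind (contentWord T) (m + 1 - d) (m + 1) := by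
    intro d h1 h4
    have := sum_Des hT h1 h4 (fun _ => 1)
    simpa using this
  have inv : ((Inv μ.card k T).card : ℤ) = ∑ m ∈ Finset.range μ.card,
      ∑ d ∈ Finset.Ico 1 k, ind (contentWord T) (m + 1 - d) (m + 1) := by
    rw [Inv, Finset.card_biUnion, Finset.sum_comm, Nat.cast_sum]
    · refine Finset.sum_congr rfl fun d hd => card d ?_ ?_ <;>
      · have := Finset.mem_Ico.1 hd
        omega
    · intro d _ d' _ hne
      refine Finset.disjoint_left.2 fun p hp hp' => hne ?_
      have e := (Finset.mem_filter.1 hp).2.1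
      have e' := (Finset.mem_filter.1 hp').2.1
      omega
  rw [maj, Nat.cast_add, inv, Nat.cast_sum, sum_Des hT h1 h4 (fun i => (i : ℤ)),
    ← Finset.sum_add_distrib]
  rfl

end SYT

theorem proposition4p2 (μ : YoungDiagram) (k : ℕ) (hk : k = 2 ∨ k = 3) :
    Set.BijOn (SYT.Φ k μ.card) (SYT μ) (SYT μ) ∧
      ∀ T ∈ SYT μ, SYT.maj μ.card (k - 1) T = SYT.maj μ.card k (SYT.Φ k μ.card T) := by
  have bij := SYT.Φ_bijOn hk (μ := μ) le_rfl
  refine ⟨bij, fun T hT => ?_⟩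
  have e : (SYT.maj μ.card (k - 1) T : ℤ) = SYT.maj μ.card k (SYT.Φ k μ.card T) := by
    rw [SYT.maj_eq_wordMaj hT (by omega) (by omega),
      SYT.maj_eq_wordMaj (bij.mapsTo hT) (by omega) (by omega), SYT.wordMaj_Φ hT hk le_rfl]
  exact_mod_cast e
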